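/- Setting. There are $R$ rounds with $n$ distinct users in each. User $i\in B_r$ (the users of round $r$) holds a local histogram $h_i:\mathcal X\to\mathbb N$ over a domain $\mathcal X$ with $|\mathcal X|=d$, with $\sum_x h_i(x)\le m$; put $h^{[R]}(x)=\sum_{r\in[R]}\sum_{i\in B_r}h_i(x)$. A shared random variable $U$ is available to all users and to the server. In an (interactive) linear sketching protocol each user $i\in B_r$ computes from $h_i$, $U$ and $Y^{(1)},\dots,Y^{(r-1)}$ an element $Y_i$ of a finite ring $G_r$; the server observes $Y^{(r)}=\sum_{i\in B_r}Y_i$, and computes an estimate $\widehat h^{[R]}:\mathcal X\to\mathbb R$ from $(Y^{(1)},\dots,Y^{(R)},U)$. The per-user communication cost is at most $\ell\in\mathbb N$ bits if $|G_r|\le 2^\ell$ for all $r$. The protocol solves $\tau$-approximate histogram on a dataset with error probability at most $\beta$ if $\Pr\big[\exists x:\ |\widehat h^{[R]}(x)-h^{[R]}(x)|>\tau\big]\le\beta$. Theorem. There is a universal constant $c>0$ such that the following holds for all $m,n,R,d,\ell\in\mathbb N$ and all real $\tau$ with $0<\tau<mnR/2$, $d\ge mnR$ and $$\ell\ \le\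 c\,\min\Big\{\frac{mn\sqrt R}{\tau},\,mn\Big\}.$$ For every $R$-round linear sketching protocol with per-user communication cost at most $\ell$ bits there is a dataset $\{h_i\}_{i\in B_r,\,r\in[R]}$ on which the protocol does not solve $\tau$-approximate histogram with error probability at most $1/5$. The same holds, with the same $c$, even if the users within a round may communicate freely, that is, for protocols in which $Y^{(r)}$ is an arbitrary function of $(h_i)_{i\in B_r}$, $U$ and $Y^{(1)},\dots,Y^{(r-1)}$ with values in a finite set $G_r$ with $|G_r|\le 2^\ell$. -/

import Mathlib

open MeasureTheory

/-- Local histograms of one user: at most `m` samples (with multiplicity) from a domain of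
size `d`. -/
def LocalHist (d m : ℕ) : Type := {h : Fin d → ℕ // ∑ x, h x ≤ m}

/-- A dataset: `R` rounds, `n` users in each round (all `n * R` users distinct), and one local
histogram per user. -/
abbrev Dataset (R n m d : ℕ) : Type := Fin R → Fin n → LocalHist d m

/-- The aggregated histogram over all users of all rounds. -/
def Dataset.total {R n m d : ℕ} (D : Dataset R n m d) (x : Fin d) : ℕ :=
  ∑ r, ∑ i, (D r i).1 x

/-- An interactive `R`-round protocol in which the users of one round may communicate freely:
in round `r` they jointly map all their local histograms, the shared randomness `ω : Ω` and the
messages of the earlier rounds to one element of a finite set `G r`, and the server estimates the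
total histogram from the shared randomness and the `R` elements. The last two fields only say that
the encoder and the decoder are random variables. -/
structure RoundProtocol (Ω : Type*) [MeasurableSpace Ω] (R n m d : ℕ) where
  /-- the message set of each round -/
  G : Fin R → Type
  finite_G : ∀ r, Finite (G r)
  /-- the joint encoder of the users of a round -/
  enc : (r : Fin R) → Ω → ((s : Fin R) → s < r → G s) → (Fin n → LocalHist d m) → G r
  /-- the estimate of the server -/
  dec : Ω → ((r : Fin R) → G r) → Fin d → ℝ
  measurable_enc : ∀ r past h g, MeasurableSet {ω | enc r ω past h = g}
  measurable_dec : ∀ y x, Measurable fun ω => dec ω y x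

namespace RoundProtocol

variable {Ω : Type*} [MeasurableSpace Ω] {R n m d : ℕ}

/-- The message that the server observes in round `r`, when the dataset is `D` and the shared
randomness is `ω`. -/
def message (P : RoundProtocol Ω R n m d) (D : Dataset R n m d) (ω : Ω) (r : Fin R) : P.G r :=
  P.enc r ω (fun s _ => P.message D ω s) (D r)
termination_by r.val
decreasing_by assumption

/-- The histogram returned by the server. -/
def estimate (P : RoundProtocol Ω R n m d) (D : Dataset R n m d) (ω : Ω) : Fin d → ℝ :=
  P.dec ω (P.message D ω)

/-- The communication cost is at most `l` bits: every round message is one of at most `2 ^ l`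
elements. -/
def CostAtMost (P : RoundProtocol Ω R n m d) (l : ℕ) : Prop :=
  ∀ r, Nat.card (P.G r) ≤ 2 ^ l

/-- On the dataset `D`, the protocol solves the `τ`-approximate histogram problem with error
probability at most `β`, for shared randomness of law `μ`. -/
def SolvesApproxHist (P : RoundProtocol Ω R n m d) (μ : Measure Ω) (τ β : ℝ)
    (D : Dataset R n m d) : Prop :=
  μ.real {ω | ¬ ∀ x, |P.estimate D ω x - (D.total x : ℝ)| ≤ τ} ≤ β

end RoundProtocol

/-- An interactive `R`-round linear sketching protocol: in round `r` user `i` maps its own local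
histogram, the shared randomness and the sums observed in the earlier rounds to an element of a
finite ring `G r`; the server observes only the sum over the users of the round, and estimates the
total histogram from the shared randomness and the `R` sums. The last two fields only say that
the encoders and the decoder are random variables. -/
structure LinSketchProtocol (Ω : Type*) [MeasurableSpace Ω] (R n m d : ℕ) where
  /-- the ring of each round -/
  G : Fin R → Type
  ring_G : ∀ r, Ring (G r)
  finite_G : ∀ r, Finite (G r)
  /-- the encoder of each user -/
  enc : (r : Fin R) → Fin n → Ω → ((s : Fin R) → s < r → G s) → LocalHist d m → G r
  /-- the estimate of the server -/
  dec : Ω → ((r : Fin R) → G r) → Fin d → ℝ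
  measurable_enc : ∀ r i past h g, MeasurableSet {ω | enc r i ω past h = g}
  measurable_dec : ∀ y x, Measurable fun ω => dec ω y x

namespace LinSketchProtocol

variable {Ω : Type*} [MeasurableSpace Ω] {R n m d : ℕ}

/-- The communication cost is at most `l` bits per user: each message, an element of the ring of
the round, takes one of at most `2 ^ l` values. -/
def CostAtMost (P : LinSketchProtocol Ω R n m d) (l : ℕ) : Prop :=
  ∀ r, Nat.card (P.G r) ≤ 2 ^ l

attribute [local instance] ring_G finite_G

/-- What the server observes: the round message is the sum of the messages of the users. -/
def toRoundProtocol (P : LinSketchProtocol Ω R n m d) : RoundProtocol Ω R n m d where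
  G := P.G
  finite_G := P.finite_G
  enc r ω past h := ∑ i, P.enc r i ω past (h i)
  dec := P.dec
  measurable_enc r past h g := by
    have key : {ω | ∑ i, P.enc r i ω past (h i) = g} =
        ⋃ v ∈ {v : Fin n → P.G r | ∑ i, v i = g},
          ⋂ i, {ω | P.enc r i ω past (h i) = v i} := by
      ext ω
      simp only [Set.mem_ofPred_eq, Set.mem_iUnion, Set.mem_iInter, exists_prop]
      constructor
      · intro hg
        exact ⟨fun i => P.enc r i ω past (h i), hg, fun _ => rfl⟩
      · rintro ⟨v, hv, hi⟩
        simpa only [hi] using hv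
    rw [key]
    exact MeasurableSet.biUnion (Set.toFinite _).countable fun v _ =>
      MeasurableSet.iInter fun i => P.measurable_enc r i past (h i) (v i)
  measurable_dec := P.measurable_dec

/-- On the dataset `D`, the protocol solves the `τ`-approximate histogram problem with error
probability at most `β`, for shared randomness of law `μ`. -/
def SolvesApproxHist (P : LinSketchProtocol Ω R n m d) (μ : Measure Ω) (τ β : ℝ)
    (D : Dataset R n m d) : Prop :=
  P.toRoundProtocol.SolvesApproxHist μ τ β D

end LinSketchProtocol

/-! Each round's users jointly encode `k = 100 * l` uniform bits, each bit with weight `M` of order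
`n * m / l`. By averaging, the shared randomness can be fixed. Messages are causal, so conditioned
on the transcript the rounds remain independent, each uniform on a fibre of its encoder. An `l`-bit
message can bias only few bits: by the level-one inequality (`sum_bias_fiber_le`) the squared biases
of a round sum to `O(l)` on average, so a typical coordinate is nearly unbiased in most rounds. A
sum of `R` independent, nearly unbiased signs spreads over a window of width `√R`, which is detected
by its characteristic function at a frequency of order `1 / √R` (`exists_frequency`, `sum_cos_le`).
Hence no estimate can have error below a constant times `M * √R` on all coordinates with probability
`4 / 5` (`card_accurate_lt`). -/

/-- The sign `±1` encoded by a bit. -/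
def bitSign (b : Bool) : ℝ := if b then 1 else -1

lemma bitSign_eq (b : Bool) : bitSign b = 2 * (b.toNat : ℝ) - 1 := by
  cases b <;> norm_num [bitSign]

/-- The bias of coordinate `j` of a uniform element of a set `A` of bit vectors. -/
noncomputable def bias {ι : Type*} (A : Finset (ι → Bool)) (j : ι) : ℝ :=
  (∑ x ∈ A, bitSign (x j)) / A.card

lemma abs_bias_le_one {ι : Type*} (A : Finset (ι → Bool)) (j : ι) : |bias A j| ≤ 1 := by
  have h : |∑ x ∈ A, bitSign (x j)| ≤ A.card := by
    refine (Finset.abs_sum_le_sum_abs _ _).trans ?_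
    refine (Finset.sum_le_card_nsmul A _ 1 fun x _ => ?_).trans (by simp)
    cases x j <;> simp [bitSign]
  rw [bias, abs_div, Nat.abs_cast]
  exact div_le_one_of_le₀ h (Nat.cast_nonneg _)

lemma bias_sq_le_one {ι : Type*} (A : Finset (ι → Bool)) (j : ι) : bias A j ^ 2 ≤ 1 :=
  (sq_le_one_iff_abs_le_one _).2 (abs_bias_le_one A j)

lemma card_mul_bias {ι : Type*} {A : Finset (ι → Bool)} (hA : A.Nonempty) (j : ι) :
    (A.card : ℝ) * bias A j = ∑ x ∈ A, bitSign (x j) := by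
  have : (A.card : ℝ) ≠ 0 := by exact_mod_cast hA.card_ne_zero
  rw [bias, mul_div_cancel₀ _ this]

/-! ### Level-one inequality: short messages reveal little bias. -/

section LevelOne

variable {ι : Type*} [Fintype ι] [DecidableEq ι]

/-- The sum factorises over coordinates, and `cosh b ≤ exp (b ^ 2 / 2)` bounds each factor. -/
lemma sum_exp_le (b : ι → ℝ) :
    ∑ x : ι → Bool, Real.exp (∑ j, b j * bitSign (x j)) ≤
      2 ^ Fintype.card ι * Real.exp ((∑ j, b j ^ 2) / 2) := by
  calc ∑ x : ι → Bool, Real.exp (∑ j, b j * bitSign (x j))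
      = ∏ j, ∑ c : Bool, Real.exp (b j * bitSign c) := by
        rw [Fintype.prod_sum]
        exact Finset.sum_congr rfl fun x _ => Real.exp_sum _ _
    _ ≤ ∏ j : ι, 2 * Real.exp (b j ^ 2 / 2) := by
        refine Finset.prod_le_prod (fun j _ => by positivity) fun j _ => ?_
        have := Real.cosh_le_exp_half_sq (b j)
        rw [Real.cosh_eq] at this
        simp only [Fintype.sum_bool, bitSign, if_true, Bool.false_eq_true, if_false, mul_one,
          mul_neg]
        linarith
    _ = _ := by
        rw [Finset.prod_mul_distrib, ← Real.exp_sum, Finset.sum_div]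
        simp

/-- The level-one inequality for a set of bit vectors. -/
lemma card_mul_exp_bias_le {A : Finset (ι → Bool)} (hA : A.Nonempty) :
    A.card * Real.exp ((∑ j, bias A j ^ 2) / 2) ≤ 2 ^ Fintype.card ι := by
  set s := ∑ j, bias A j ^ 2 with hs
  have h1 : ∑ x ∈ A, ∑ j, bias A j * bitSign (x j) = A.card * s := by
    rw [Finset.sum_comm, hs, Finset.mul_sum]
    refine Finset.sum_congr rfl fun j _ => ?_
    rw [← Finset.mul_sum, ← card_mul_bias hA]
    ring
  -- Jensen's inequality through the tangent of `exp` at `s`: the linear form with the biases as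
  -- weights has mean exactly `s` over `A`.
  have h2 : A.card * Real.exp s ≤ ∑ x ∈ A, Real.exp (∑ j, bias A j * bitSign (x j)) := by
    calc (A.card : ℝ) * Real.exp s
        = ∑ x ∈ A, Real.exp s * (∑ j, bias A j * bitSign (x j) - s + 1) := by
          rw [← Finset.mul_sum, Finset.sum_add_distrib, Finset.sum_sub_distrib, h1]
          simp
          ring
      _ ≤ _ := by
          refine Finset.sum_le_sum fun x _ => ?_
          refine (mul_le_mul_of_nonneg_left (Real.add_one_le_exp _) (Real.exp_pos s).le).trans ?_
          rw [← Real.exp_add]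
          simp
  have h3 := h2.trans ((Finset.sum_le_sum_of_subset_of_nonneg (Finset.subset_univ A)
    fun _ _ _ => (Real.exp_pos _).le).trans (sum_exp_le (bias A)))
  rw [← hs] at h3
  have h4 : Real.exp s = Real.exp (s / 2) * Real.exp (s / 2) := by
    rw [← Real.exp_add]; ring_nf
  rw [h4, ← mul_assoc] at h3
  exact le_of_mul_le_mul_right h3 (Real.exp_pos _)

/-- A uniform bit vector, conditioned on a message of at most `2 ^ l` values, has average squared
bias `O(l)`. -/
lemma sum_bias_fiber_le {γ : Type*} [Fintype γ] [DecidableEq γ] {l : ℕ}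
    (hγ : Fintype.card γ ≤ 2 ^ l) (f : (ι → Bool) → γ) :
    ∑ x, ∑ j, bias {y | f y = f x} j ^ 2 ≤
      2 ^ Fintype.card ι * (2 * (l * Real.log 2)) := by
  set L := l * Real.log 2 with hL
  have hexpL : Real.exp L = 2 ^ l := by
    rw [hL, Real.exp_nat_mul, Real.exp_log (by norm_num)]
  -- Each of the at most `2 ^ l` fibres contributes at most `2 ^ card ι`.
  have hsum : ∑ x, Real.exp ((∑ j, bias {y | f y = f x} j ^ 2) / 2) ≤
      2 ^ l * 2 ^ Fintype.card ι := by
    rw [← Finset.sum_fiberwise (s := Finset.univ) (g := f)]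
    calc _ ≤ ∑ _g : γ, (2 : ℝ) ^ Fintype.card ι := by
          refine Finset.sum_le_sum fun g _ => ?_
          rcases Finset.eq_empty_or_nonempty ({y | f y = g} : Finset (ι → Bool)) with h | h
          · rw [h]; simp
          · refine le_trans (le_of_eq ?_) (card_mul_exp_bias_le h)
            rw [← nsmul_eq_mul, ← Finset.sum_const]
            refine Finset.sum_congr rfl fun x hx => ?_
            rw [(Finset.mem_filter.1 hx).2]
      _ ≤ _ := by
          rw [Finset.sum_const, nsmul_eq_mul, Finset.card_univ]
          gcongr
          exact_mod_cast hγ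
  -- The tangent of `exp` at `L = log (2 ^ l)` turns the exponential moment into a bound `2 * L` on
  -- the mean, with no additive loss.
  have hpt : ∀ x : ι → Bool, ∑ j, bias {y | f y = f x} j ^ 2 ≤
      2 * (Real.exp ((∑ j, bias {y | f y = f x} j ^ 2) / 2) / 2 ^ l + (L - 1)) := by
    intro x
    have := Real.add_one_le_exp ((∑ j, bias {y | f y = f x} j ^ 2) / 2 - L)
    rw [Real.exp_sub, hexpL] at this
    linarith
  refine (Finset.sum_le_sum fun x _ => hpt x).trans ?_
  rw [← Finset.mul_sum, Finset.sum_add_distrib, ← Finset.sum_div]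
  have h5 : (∑ x, Real.exp ((∑ j, bias {y | f y = f x} j ^ 2) / 2)) / 2 ^ l ≤
      2 ^ Fintype.card ι := by
    rw [div_le_iff₀ (by positivity)]
    linarith
  simp only [Finset.sum_const, Finset.card_univ, Fintype.card_fun, Fintype.card_bool,
    nsmul_eq_mul, Nat.cast_pow, Nat.cast_ofNat]
  linarith

end LevelOne

/-! ### Anti-concentration through characteristic functions. -/

section AntiConcentration

lemma exp_mul_bitSign (θ : ℝ) (b : Bool) :
    Complex.exp ((θ * bitSign b : ℝ) * Complex.I) =
      (Real.cos θ : ℂ) + (bitSign b : ℂ) * Real.sin θ * Complex.I := by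
  rw [Complex.exp_mul_I, ← Complex.ofReal_cos, ← Complex.ofReal_sin]
  cases b <;> simp [bitSign]

lemma norm_sum_exp_bitSign {ι : Type*} {A : Finset (ι → Bool)} (hA : A.Nonempty) (θ : ℝ)
    (j : ι) :
    ‖∑ x ∈ A, Complex.exp ((θ * bitSign (x j) : ℝ) * Complex.I)‖ =
      A.card * Real.sqrt (Real.cos θ ^ 2 + bias A j ^ 2 * Real.sin θ ^ 2) := by
  have h : ∑ x ∈ A, Complex.exp ((θ * bitSign (x j) : ℝ) * Complex.I) =
      (A.card : ℂ) * ((Real.cos θ : ℝ) + (bias A j * Real.sin θ : ℝ) * Complex.I) := by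
    simp only [exp_mul_bitSign]
    rw [Finset.sum_add_distrib, ← Finset.sum_mul, ← Finset.sum_mul,
      ← Complex.ofReal_sum A (fun x => bitSign (x j)), ← card_mul_bias hA]
    simp
    ring
  rw [h, norm_mul, Complex.norm_natCast, Complex.norm_add_mul_I, mul_pow]

/-- The characteristic function of a sum of coordinates over a product set. -/
lemma sum_cos_piFinset_le {ρ ι : Type*} [Fintype ρ] [DecidableEq ρ]
    (F : ρ → Finset (ι → Bool)) (j : ι) (θ a : ℝ) :
    ∑ x ∈ Fintype.piFinset F, Real.cos (θ * (∑ r, bitSign (x r j) - a)) ≤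
      (Fintype.piFinset F).card *
        ∏ r, Real.sqrt (Real.cos θ ^ 2 + bias (F r) j ^ 2 * Real.sin θ ^ 2) := by
  rcases Finset.eq_empty_or_nonempty (Fintype.piFinset F) with h | h
  · simp [h]
  have hF : ∀ r, (F r).Nonempty := Fintype.piFinset_nonempty.1 h
  have h1 : (∑ x ∈ Fintype.piFinset F, Real.cos (θ * (∑ r, bitSign (x r j) - a)) : ℝ) =
      (Complex.exp ((-(θ * a) : ℝ) * Complex.I) *
        ∏ r, ∑ y ∈ F r, Complex.exp ((θ * bitSign (y j) : ℝ) * Complex.I)).re := by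
    rw [Finset.prod_univ_sum, Finset.mul_sum, Complex.re_sum]
    refine Finset.sum_congr rfl fun x _ => ?_
    rw [← Complex.exp_sum, ← Complex.exp_add, ← Finset.sum_mul, ← Complex.ofReal_sum, ← add_mul,
      ← Complex.ofReal_add, Complex.exp_ofReal_mul_I_re, ← Finset.mul_sum]
    congr 1
    ring
  rw [h1]
  -- The shift `a` is only a phase, so it disappears in the norm.
  refine (Complex.re_le_norm _).trans (le_of_eq ?_)
  rw [norm_mul, Complex.norm_exp_ofReal_mul_I, one_mul, norm_prod,
    Fintype.card_piFinset, Nat.cast_prod, ← Finset.prod_mul_distrib]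
  exact Finset.prod_congr rfl fun r _ => norm_sum_exp_bitSign (hF r) θ j

/-- A frequency of order `1 / √R` at which the characteristic function of a sum of `R` nearly
unbiased signs is bounded away from `1`. -/
lemma exists_frequency {R : ℕ} (hR : 0 < R) :
    ∃ θ : ℝ, 0 ≤ θ ∧ θ * Real.sqrt R ≤ 5 / 2 ∧
      ∀ β : Fin R → ℝ, (∀ r, β r ^ 2 ≤ 1) →
        ∏ r, Real.sqrt (Real.cos θ ^ 2 + β r ^ 2 * Real.sin θ ^ 2) ≤
          1 / 2 + (∑ r, β r ^ 2) / R := by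
  -- The choice `sin θ ^ 2 = 2 / R` below needs `2 ≤ R`. For `R = 1`, `θ = π / 2` leaves `|β 0| ≤ 1
  -- / 2 + β 0 ^ 2`.
  obtain rfl | hR2 : R = 1 ∨ 2 ≤ R := by omega
  · refine ⟨Real.pi / 2, by positivity, ?_, fun β _ => ?_⟩
    · have := Real.pi_lt_d2
      simp
      linarith
    · simp only [Finset.univ_unique, Fin.default_eq_zero, Finset.prod_singleton,
        Finset.sum_singleton, Real.cos_pi_div_two, Real.sin_pi_div_two, Nat.cast_one, div_one,
        one_pow, mul_one]
      rw [Real.sqrt_le_left (by positivity)]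
      nlinarith [sq_nonneg (β 0), sq_nonneg (β 0 ^ 2)]
  have hR2' : (2 : ℝ) ≤ R := by exact_mod_cast hR2
  have hs1 : Real.sqrt (2 / R) ≤ 1 := by
    refine Real.sqrt_le_one.2 ?_
    exact div_le_one_of_le₀ hR2' (by positivity)
  have hs0 := Real.sqrt_nonneg (2 / R : ℝ)
  set θ := Real.arcsin (Real.sqrt (2 / R)) with hθ
  have hsin : Real.sin θ = Real.sqrt (2 / R) := Real.sin_arcsin (by linarith) hs1
  have hsin2 : Real.sin θ ^ 2 = 2 / R := by rw [hsin, Real.sq_sqrt (by positivity)]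
  have hθ0 : 0 ≤ θ := Real.arcsin_nonneg.2 hs0
  refine ⟨θ, hθ0, ?_, fun β hβ => ?_⟩
  · have h1 := Real.mul_le_sin hθ0 (Real.arcsin_le_pi_div_two _)
    have h2 : Real.sin θ * Real.sqrt R = Real.sqrt 2 := by
      rw [hsin, ← Real.sqrt_mul (by positivity), div_mul_cancel₀ _ (by positivity)]
    have h3 : 2 / Real.pi * (θ * Real.sqrt R) ≤ Real.sqrt 2 := by
      rw [← h2, ← mul_assoc]
      gcongr
    have h4 : Real.sqrt 2 ≤ 3 / 2 := by
      rw [Real.sqrt_le_left (by norm_num)]; norm_num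
    have hpi := Real.pi_pos
    rw [div_mul_eq_mul_div, div_le_iff₀ hpi] at h3
    have := Real.pi_lt_d2
    nlinarith
  · set B := (∑ r, β r ^ 2) / R with hB
    have hB0 : 0 ≤ B := by positivity
    have hB1 : B ≤ 1 := by
      rw [hB]
      refine div_le_one_of_le₀ ?_ (by positivity)
      exact (Finset.sum_le_sum fun r _ => hβ r).trans (by simp)
    -- The squared factor is `1 - 2 * (1 - β r ^ 2) / R`. The product is then at most `exp (-(1 -
    -- B)) ≤ 1 / (2 - B) ≤ 1 / 2 + B`, as `0 ≤ B ≤ 1`.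
    have hfac : ∀ r, Real.sqrt (Real.cos θ ^ 2 + β r ^ 2 * Real.sin θ ^ 2) ≤
        Real.exp (-((1 - β r ^ 2) / R)) := by
      intro r
      rw [Real.sqrt_le_left (Real.exp_pos _).le, ← Real.exp_nat_mul, Real.cos_sq', hsin2]
      refine le_trans (le_of_eq ?_) (Real.add_one_le_exp _)
      push_cast
      ring
    refine (Finset.prod_le_prod (fun r _ => Real.sqrt_nonneg _) fun r _ => hfac r).trans ?_
    rw [← Real.exp_sum]
    have hexp : ∑ r, -((1 - β r ^ 2) / (R : ℝ)) = -(1 - B) := by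
      rw [Finset.sum_neg_distrib, ← Finset.sum_div, Finset.sum_sub_distrib, sub_div, hB]
      simp [div_self (show (R : ℝ) ≠ 0 by positivity)]
    rw [hexp, Real.exp_neg]
    have h1 := Real.add_one_le_exp (1 - B)
    rw [inv_le_iff_one_le_mul₀ (Real.exp_pos _)]
    nlinarith

end AntiConcentration

/-! ### Transcripts of causal protocols. -/

section Transcript

variable {R : ℕ} {G : Fin R → Type*} {Y : Type*}

/-- `e r t y`, the message of round `r` on input `y`, depends on the transcript `t` only through
the messages of the earlier rounds. -/
def IsCausal (e : (r : Fin R) → ((s : Fin R) → G s) → Y → G r) : Prop :=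
  ∀ r t t', (∀ s < r, t s = t' s) → e r t = e r t'

variable {e : (r : Fin R) → ((s : Fin R) → G s) → Y → G r} (he : IsCausal e)
  {T : (Fin R → Y) → (r : Fin R) → G r} (hT : ∀ x r, T x r = e r (T x) (x r))

include he hT

/-- Makes transcript fibres product sets over the rounds, which is the conditional independence. -/
lemma transcript_eq_iff (x : Fin R → Y) (t : (r : Fin R) → G r) :
    T x = t ↔ ∀ r, e r t (x r) = t r := by
  constructor
  · rintro rfl r
    exact (hT x r).symm
  · intro h
    have key : ∀ r, T x r = t r := by
      intro r
      induction r using WellFoundedLT.induction with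
      | ind r ih => rw [hT, he r (T x) t ih, h]
    exact funext key

lemma transcript_update_of_lt (x : Fin R → Y) (r : Fin R) (y : Y) (s : Fin R) (hs : s < r) :
    T (Function.update x r y) s = T x s := by
  induction s using WellFoundedLT.induction with
  | ind s ih =>
    rw [hT, hT x, Function.update_of_ne hs.ne,
      he s _ (T x) fun u hu => ih u hu (hu.trans hs)]

end Transcript

/-- Resampling one coordinate of a uniform tuple does not change averages. -/
lemma sum_sum_update {ρ Y : Type*} [Fintype ρ] [DecidableEq ρ] [Fintype Y]
    (φ : (ρ → Y) → ℝ) (r : ρ) :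
    ∑ x, ∑ y, φ (Function.update x r y) = Fintype.card Y * ∑ x, φ x := by
  -- Swapping the resampled value with the old coordinate is an involution.
  let E : (ρ → Y) × Y ≃ (ρ → Y) × Y := Function.Involutive.toPerm
    (fun p => (Function.update p.1 r p.2, p.1 r)) (fun p => by simp)
  rw [← Fintype.sum_prod_type' (f := fun x y => φ (Function.update x r y)),
    show ∑ p : (ρ → Y) × Y, φ (Function.update p.1 r p.2) = ∑ p, φ (E p).1 from rfl,
    Equiv.sum_comp E (fun p => φ p.1), Fintype.sum_prod_type]
  simp [Finset.mul_sum]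

/-! ### The lower bound for random bits. -/

section Core

variable {R k l : ℕ} {G : Fin R → Type*} [∀ r, Fintype (G r)] [∀ r, DecidableEq (G r)]
  {e : (r : Fin R) → ((s : Fin R) → G s) → (Fin k → Bool) → G r}
  {T : (Fin R → Fin k → Bool) → (r : Fin R) → G r}

/-- Resampling the input of round `r` leaves the earlier messages unchanged, so the message of round
`r` becomes a fixed function of a fresh uniform input and the fibre bound applies. -/
lemma sum_bias_round_le (hG : ∀ r, Fintype.card (G r) ≤ 2 ^ l) (he : IsCausal e)
    (hT : ∀ x r, T x r = e r (T x) (x r)) (r : Fin R) :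
    ∑ x, ∑ j, bias {y | e r (T x) y = T x r} j ^ 2 ≤
      Fintype.card (Fin R → Fin k → Bool) * (2 * (l * Real.log 2)) := by
  have h := sum_sum_update (fun x => ∑ j, bias {y | e r (T x) y = T x r} j ^ 2) r
  have h2 : ∀ x : Fin R → Fin k → Bool,
      ∑ y, ∑ j, bias {z | e r (T (Function.update x r y)) z = T (Function.update x r y) r} j ^ 2
        ≤ 2 ^ k * (2 * (l * Real.log 2)) := by
    intro x
    have h3 := sum_bias_fiber_le (hG r) (e r (T x))
    rw [Fintype.card_fin] at h3
    refine le_trans (le_of_eq (Finset.sum_congr rfl fun y _ => ?_)) h3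
    rw [hT (Function.update x r y) r, Function.update_self,
      he r _ (T x) (transcript_update_of_lt he hT x r y)]
  have h4 := Finset.sum_le_sum fun x (_ : x ∈ Finset.univ) => h2 x
  rw [h, Finset.sum_const, nsmul_eq_mul, Finset.card_univ] at h4
  have hY : (Fintype.card (Fin k → Bool) : ℝ) = 2 ^ k := by simp
  rw [hY] at h4
  have h5 : (0 : ℝ) < 2 ^ k := by positivity
  refine le_of_mul_le_mul_left ?_ h5
  linarith

/-- On a transcript fibre the estimate is a constant shift and the inputs form a product set. -/
lemma sum_cos_le (he : IsCausal e) (hT : ∀ x r, T x r = e r (T x) (x r))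
    (a : ((r : Fin R) → G r) → ℝ) (j : Fin k) (θ : ℝ) :
    ∑ x, Real.cos (θ * (∑ r, bitSign (x r j) - a (T x))) ≤
      ∑ x, ∏ r, Real.sqrt (Real.cos θ ^ 2 +
        bias {y | e r (T x) y = T x r} j ^ 2 * Real.sin θ ^ 2) := by
  rw [← Finset.sum_fiberwise (s := Finset.univ) (g := T),
    ← Finset.sum_fiberwise (s := Finset.univ) (g := T)
      (f := fun x => ∏ r, Real.sqrt (Real.cos θ ^ 2 +
        bias {y | e r (T x) y = T x r} j ^ 2 * Real.sin θ ^ 2))]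
  refine Finset.sum_le_sum fun t _ => ?_
  have hfib : (Finset.univ.filter fun x => T x = t) =
      Fintype.piFinset fun r => ({y | e r t y = t r} : Finset (Fin k → Bool)) := by
    ext x
    simp [transcript_eq_iff he hT, Fintype.mem_piFinset]
  have h1 : ∑ x with T x = t, Real.cos (θ * (∑ r, bitSign (x r j) - a (T x))) =
      ∑ x with T x = t, Real.cos (θ * (∑ r, bitSign (x r j) - a t)) :=
    Finset.sum_congr rfl fun x hx => by rw [(Finset.mem_filter.1 hx).2]
  have h2 : ∑ x with T x = t, ∏ r, Real.sqrt (Real.cos θ ^ 2 +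
        bias {y | e r (T x) y = T x r} j ^ 2 * Real.sin θ ^ 2) =
      ∑ x with T x = t, ∏ r, Real.sqrt (Real.cos θ ^ 2 +
        bias {y | e r t y = t r} j ^ 2 * Real.sin θ ^ 2) :=
    Finset.sum_congr rfl fun x hx => by rw [(Finset.mem_filter.1 hx).2]
  rw [h1, h2, hfib, Finset.sum_const, nsmul_eq_mul]
  exact sum_cos_piFinset_le _ j θ (a t)

/-- From a transcript of `R` messages of `l` bits about uniform bits `x r j`, with `100 * l`
values of `j`, one cannot estimate all the sums over `r` within `√R / 100` with probability
`4 / 5`. -/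
lemma card_accurate_lt (hR : 0 < R) (hl : 0 < l) (hk : k = 100 * l)
    (hG : ∀ r, Fintype.card (G r) ≤ 2 ^ l) (he : IsCausal e)
    (hT : ∀ x r, T x r = e r (T x) (x r)) (a : ((r : Fin R) → G r) → Fin k → ℝ)
    (A : Finset (Fin R → Fin k → Bool))
    (hA : ∀ x ∈ A, ∀ j, |∑ r, bitSign (x r j) - a (T x) j| ≤ Real.sqrt R / 100) :
    5 * (A.card : ℝ) < 4 * Fintype.card (Fin R → Fin k → Bool) := by
  obtain ⟨θ, hθ0, hθ, hprod⟩ := exists_frequency hR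
  set q : ℝ := ((Fintype.card (Fin R → Fin k → Bool) : ℕ) : ℝ) with hq
  have hq0 : 0 < q := by rw [hq]; exact_mod_cast Fintype.card_pos
  -- The cosine is at least `0.999` on `A`, where its argument is at most `(5 / 2) / 100 = 1 / 40`,
  -- and at least `-1` elsewhere.
  have hlow : ∀ j, (A.card : ℝ) * (1999 / 1000) - q ≤
      ∑ x, Real.cos (θ * (∑ r, bitSign (x r j) - a (T x) j)) := by
    intro j
    rw [← Finset.sum_add_sum_compl A]
    have h1 : (A.card : ℝ) * (999 / 1000) ≤
        ∑ x ∈ A, Real.cos (θ * (∑ r, bitSign (x r j) - a (T x) j)) := by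
      rw [← nsmul_eq_mul]
      refine Finset.card_nsmul_le_sum _ _ _ fun x hx => ?_
      have h2 : |θ * (∑ r, bitSign (x r j) - a (T x) j)| ≤ 1 / 40 := by
        rw [abs_mul, abs_of_nonneg hθ0]
        refine (mul_le_mul_of_nonneg_left (hA x hx j) hθ0).trans ?_
        linarith
      have h3 := Real.one_sub_sq_div_two_le_cos
        (x := θ * (∑ r, bitSign (x r j) - a (T x) j))
      have h4 := sq_le_sq' (abs_le.1 h2).1 (abs_le.1 h2).2
      linarith
    have h5 : ((Aᶜ).card : ℝ) * (-1) ≤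
        ∑ x ∈ Aᶜ, Real.cos (θ * (∑ r, bitSign (x r j) - a (T x) j)) := by
      rw [← nsmul_eq_mul]
      exact Finset.card_nsmul_le_sum _ _ _ fun x _ => Real.neg_one_le_cos _
    have h6 : (A.card : ℝ) + (Aᶜ).card = q := by
      rw [hq]; exact_mod_cast Finset.card_add_card_compl A
    linarith
  have hR' : (0 : ℝ) < R := by exact_mod_cast hR
  have hup : ∑ j, ∑ x, Real.cos (θ * (∑ r, bitSign (x r j) - a (T x) j)) ≤
      k * (q / 2) + q * (2 * (l * Real.log 2)) := by
    calc _ ≤ ∑ j, ∑ x, (1 / 2 + (∑ r, bias {y | e r (T x) y = T x r} j ^ 2) / R) := by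
          refine Finset.sum_le_sum fun j _ =>
            (sum_cos_le he hT (fun t => a t j) j θ).trans ?_
          exact Finset.sum_le_sum fun x _ => hprod _ fun r => bias_sq_le_one _ _
      _ = k * (q / 2) +
          (∑ r, ∑ x, ∑ j, bias {y | e r (T x) y = T x r} j ^ 2) / R := by
          simp only [Finset.sum_add_distrib, ← Finset.sum_div]
          congr 1
          · simp [hq, mul_div_assoc]
          · congr 1
            rw [Finset.sum_comm, Finset.sum_comm (s := (Finset.univ : Finset (Fin R)))]
            exact Finset.sum_congr rfl fun x _ => Finset.sum_comm
      _ ≤ _ := by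
          gcongr
          rw [div_le_iff₀ hR']
          refine (Finset.sum_le_sum fun r _ => sum_bias_round_le hG he hT r).trans
            (le_of_eq ?_)
          rw [Finset.sum_const, nsmul_eq_mul, Finset.card_univ, Fintype.card_fin, ← hq]
          ring
  have hlow' := Finset.sum_le_sum fun j (_ : j ∈ Finset.univ) => hlow j
  rw [Finset.sum_const, nsmul_eq_mul, Finset.card_univ, Fintype.card_fin] at hlow'
  have hkl : (k : ℝ) = 100 * l := by exact_mod_cast hk
  have hl' : (0 : ℝ) < l := by exact_mod_cast hl
  have hlog := Real.log_two_lt_d9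
  -- Were `A` to have density at least `4 / 5`, the mean cosine would be at least `0.8 * 1.999 - 1 >
  -- 0.59`, but it is at most `1 / 2 + 2 * log 2 / 100 < 0.52`.
  by_contra! hcon
  have h7 := hlow'.trans hup
  rw [hkl] at h7
  have h8 : 100 * ((A.card : ℝ) * (1999 / 1000) - q) ≤
      100 * (q / 2) + q * (2 * Real.log 2) := by
    refine le_of_mul_le_mul_left ?_ hl'
    linarith
  nlinarith

end Core

/-! ### Encoding bits in histograms and fixing the randomness. -/

lemma exists_le_sum_eq {ι : Type*} [Fintype ι] [DecidableEq ι] (H : ι → ℕ) (s : ℕ)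
    (hs : s ≤ ∑ x, H x) : ∃ g : ι → ℕ, g ≤ H ∧ ∑ x, g x = s := by
  induction s with
  | zero => exact ⟨0, fun _ => Nat.zero_le _, by simp⟩
  | succ s ih =>
    obtain ⟨g, hg, hsum⟩ := ih (by omega)
    obtain ⟨x, -, hx⟩ := Finset.exists_lt_of_sum_lt (s := Finset.univ) (f := g) (g := H)
      (by omega)
    refine ⟨g + Pi.single x 1, fun y => ?_, by simp [Finset.sum_add_distrib, hsum]⟩
    rcases eq_or_ne y x with rfl | hy
    · simpa using hx
    · simpa [hy] using hg y

/-- A histogram of at most `n * m` samples can be distributed among `n` users. -/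
lemma exists_localHist_sum_eq {d m : ℕ} (n : ℕ) (H : Fin d → ℕ) (hH : ∑ x, H x ≤ n * m) :
    ∃ h : Fin n → LocalHist d m, ∀ x, ∑ i, (h i).1 x = H x := by
  induction n generalizing H with
  | zero =>
    refine ⟨Fin.elim0, fun x => ?_⟩
    have := Finset.single_le_sum (f := H) (fun _ _ => Nat.zero_le _) (Finset.mem_univ x)
    simp only [Finset.univ_eq_empty, Finset.sum_empty]
    omega
  | succ n ih =>
    -- The first user takes as many samples as allowed; the rest fit among the other `n` users.
    obtain ⟨g, hg, hsum⟩ := exists_le_sum_eq H (min m (∑ x, H x)) (min_le_right _ _)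
    have hsub : ∑ x, (H x - g x) + ∑ x, g x = ∑ x, H x := by
      rw [← Finset.sum_add_distrib]
      exact Finset.sum_congr rfl fun x _ => Nat.sub_add_cancel (hg x)
    obtain ⟨h, hh⟩ := ih (fun x => H x - g x) (by rw [add_mul] at hH; omega)
    obtain ⟨u, rfl⟩ : ∃ u : LocalHist d m, u.1 = g := ⟨⟨g, by omega⟩, rfl⟩
    refine ⟨Fin.cons u h, fun x => ?_⟩
    rw [Fin.sum_univ_succ]
    simp only [Fin.cons_zero, Fin.cons_succ, hh]
    exact Nat.add_sub_cancel' (hg x)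

/-- The users of a round can encode `k` bits, with weight `M` each, in their histograms. -/
lemma exists_localHist_bits {d m n k M : ℕ} (hkd : k ≤ d) (hM : k * M ≤ n * m)
    (b : Fin k → Bool) :
    ∃ h : Fin n → LocalHist d m,
      ∀ j, ∑ i, (h i).1 (Fin.castLE hkd j) = M * (b j).toNat := by
  obtain ⟨h, hh⟩ := exists_localHist_sum_eq (d := d) (m := m) n
    (fun y => ∑ j, if Fin.castLE hkd j = y then M * (b j).toNat else 0) (by
      rw [Finset.sum_comm]
      refine le_trans (Finset.sum_le_sum (g := fun _ => M) fun j _ => ?_) (by simpa using hM)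
      cases b j <;> simp)
  exact ⟨h, fun j => by simp [hh, (Fin.castLE_injective hkd).eq_iff]⟩

/-- If each of finitely many events has probability at most `1 / 5`, then some outcome avoids at
least four fifths of them. -/
lemma exists_avoiding {Ω ι : Type*} [MeasurableSpace Ω] (μ : Measure Ω) [IsProbabilityMeasure μ]
    [Fintype ι] (E : ι → Set Ω) (hE : ∀ i, μ.real (E i) ≤ 1 / 5) :
    ∃ ω, ∃ A : Finset ι, (∀ i ∈ A, ω ∉ E i) ∧ 4 * (Fintype.card ι : ℝ) ≤ 5 * A.card := by
  classical
  -- The events need not be measurable; their measurable hulls have the same probabilities. Some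
  -- outcome lies in no more hulls than the mean number.
  have hmeas : ∀ i, MeasurableSet (toMeasurable μ (E i)) := fun i => measurableSet_toMeasurable _ _
  have hint : ∀ i, Integrable ((toMeasurable μ (E i)).indicator fun _ => (1 : ℝ)) μ :=
    fun i => (integrable_const _).indicator (hmeas i)
  obtain ⟨ω, hω⟩ := exists_le_integral (μ := μ)
    (f := fun ω => ∑ i, (toMeasurable μ (E i)).indicator (fun _ => (1 : ℝ)) ω)
    (integrable_finsetSum _ fun i _ => hint i)
  rw [integral_finsetSum _ fun i _ => hint i] at hω
  have hle : ∑ i, ∫ ω, (toMeasurable μ (E i)).indicator (fun _ => (1 : ℝ)) ω ∂μ ≤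
      Fintype.card ι * (1 / 5) := by
    refine (Finset.sum_le_card_nsmul Finset.univ _ (1 / 5) fun i _ => ?_).trans (by simp)
    rw [integral_indicator_const _ (hmeas i)]
    simpa [Measure.real, measure_toMeasurable] using hE i
  refine ⟨ω, Finset.univ.filter fun i => ω ∉ toMeasurable μ (E i), fun i hi h =>
    (Finset.mem_filter.1 hi).2 (subset_toMeasurable _ _ h), ?_⟩
  have hsum : ∑ i, (toMeasurable μ (E i)).indicator (fun _ => (1 : ℝ)) ω +
      (({i | ω ∉ toMeasurable μ (E i)} : Finset ι).card : ℝ) = Fintype.card ι := by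
    rw [Finset.card_filter, Nat.cast_sum, ← Finset.sum_add_distrib, Fintype.card_eq_sum_ones,
      Nat.cast_sum]
    refine Finset.sum_congr rfl fun i _ => ?_
    by_cases h : ω ∈ toMeasurable μ (E i) <;> simp [h]
  linarith

/-! ### From random bits to protocols. -/

namespace RoundProtocol

variable {Ω : Type*} [MeasurableSpace Ω] {R n m d l : ℕ}

lemma message_eq (P : RoundProtocol Ω R n m d) (D : Dataset R n m d) (ω : Ω) (r : Fin R) :
    P.message D ω r = P.enc r ω (fun s _ => P.message D ω s) (D r) := by
  rw [message]

/-- Without communication, the empty dataset and a dataset with all samples equal cannot be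
told apart. -/
lemma exists_not_solves_of_cost_zero (μ : Measure Ω) [IsProbabilityMeasure μ]
    (P : RoundProtocol Ω R n m d) (hP : P.CostAtMost 0) {τ : ℝ} (hτ : 0 < τ)
    (hτN : 2 * τ < (m * n * R : ℕ)) (hd : m * n * R ≤ d) :
    ∃ D : Dataset R n m d, ¬ P.SolvesApproxHist μ τ (1 / 5) D := by
  by_contra! hcon
  have hpos : 0 < m * n * R := by
    have : (0 : ℝ) < (m * n * R : ℕ) := by linarith
    exact_mod_cast this
  let x₀ : Fin d := ⟨0, by omega⟩
  let D : Bool → Dataset R n m d := fun b _ _ =>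
    ⟨Pi.single x₀ (m * b.toNat), by rw [Finset.sum_pi_single']; cases b <;> simp⟩
  have htot : ∀ b, (D b).total x₀ = m * n * R * b.toNat := by
    intro b
    simp [D, Dataset.total]
    ring
  have hsub : ∀ r, Subsingleton (P.G r) := fun r =>
    haveI := P.finite_G r
    Finite.card_le_one_iff_subsingleton.1 (by simpa using hP r)
  obtain ⟨ω, A, hA, hcard⟩ := exists_avoiding μ _ fun b => hcon (D b)
  -- Four fifths of two datasets means both.
  have hA2 : A = Finset.univ := by
    rw [← Finset.card_eq_iff_eq_univ]
    have h1 := Finset.card_le_univ A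
    rw [Fintype.card_bool] at hcard h1 ⊢
    have h2 : (1 : ℝ) < A.card := by push_cast at hcard; linarith
    have : 1 < A.card := by exact_mod_cast h2
    omega
  have hgood : ∀ b, |P.estimate (D b) ω x₀ - ((D b).total x₀ : ℝ)| ≤ τ := by
    intro b
    have h := hA b (by simp [hA2])
    simp only [Set.mem_ofPred_eq, not_not] at h
    exact h x₀
  have hest : P.estimate (D true) ω = P.estimate (D false) ω := by
    rw [estimate, estimate]
    congr 1
    exact funext fun r => (hsub r).elim _ _
  have h0 := hgood false
  have h1 := hgood true
  rw [hest] at h1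
  rw [htot] at h0 h1
  simp only [Bool.toNat_true, Bool.toNat_false, mul_one, mul_zero, Nat.cast_zero, sub_zero]
    at h0 h1
  rw [abs_le] at h0 h1
  linarith

/-- The lower bound with explicit weights: `M` samples for each of `100 * l` bits. -/
lemma exists_not_solves_of_weight (μ : Measure Ω) [IsProbabilityMeasure μ]
    (P : RoundProtocol Ω R n m d) (hP : P.CostAtMost l) (hR : 0 < R) (hl : 0 < l) {M : ℕ}
    (hM0 : 0 < M) (hkd : 100 * l ≤ d) (hM : 100 * l * M ≤ n * m) {τ : ℝ}
    (hτ : 200 * τ ≤ M * Real.sqrt R) :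
    ∃ D : Dataset R n m d, ¬ P.SolvesApproxHist μ τ (1 / 5) D := by
  classical
  by_contra! hcon
  choose h hh using fun b : Fin (100 * l) → Bool => exists_localHist_bits hkd hM b
  let D : (Fin R → Fin (100 * l) → Bool) → Dataset R n m d := fun x r => h (x r)
  have htot : ∀ x j, ((D x).total (Fin.castLE hkd j) : ℝ) =
      M * ((∑ r, bitSign (x r j) + R) / 2) := by
    intro x j
    have : (D x).total (Fin.castLE hkd j) = M * ∑ r, (x r j).toNat := by
      simp only [D, Dataset.total, hh, Finset.mul_sum]
    rw [this]
    simp only [bitSign_eq, Finset.sum_sub_distrib, ← Finset.mul_sum]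
    simp
  have := fun r => P.finite_G r
  let _ := fun r => Fintype.ofFinite (P.G r)
  obtain ⟨ω, A, hA, hcard⟩ := exists_avoiding μ _ fun x => hcon (D x)
  have hG : ∀ r, Fintype.card (P.G r) ≤ 2 ^ l := fun r => by
    rw [← Nat.card_eq_fintype_card]; exact hP r
  have hMpos : (0 : ℝ) < M := by exact_mod_cast hM0
  refine absurd hcard (not_le.2 (card_accurate_lt hR hl rfl hG
    (e := fun r t b => P.enc r ω (fun s _ => t s) (h b)) (T := fun x => P.message (D x) ω)
    ?_ (fun x r => P.message_eq (D x) ω r)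
    -- Inverts `total = M * (S + R) / 2`, with `S` the sum of signs. An error `τ` in the total
    -- becomes `2 * τ / M ≤ √R / 100` in `S`.
    (fun t j => 2 * P.dec ω t (Fin.castLE hkd j) / M - R) A fun x hx j => ?_))
  · intro r t t' htt
    funext b
    have : (fun s (_ : s < r) => t s) = fun s _ => t' s :=
      funext fun s => funext fun hs => htt s hs
    simp only [this]
  · have hgood := hA x hx
    simp only [Set.mem_ofPred_eq, not_not] at hgood
    have h1 := hgood (Fin.castLE hkd j)
    rw [htot] at h1
    have h2 : ∑ r, bitSign (x r j) -
        (2 * P.dec ω (P.message (D x) ω) (Fin.castLE hkd j) / M - R) =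
        -(2 / M) * (P.estimate (D x) ω (Fin.castLE hkd j) -
          M * ((∑ r, bitSign (x r j) + R) / 2)) := by
      rw [estimate]
      field_simp
      ring
    rw [h2, abs_mul, abs_neg, abs_of_pos (by positivity)]
    refine (mul_le_mul_of_nonneg_left h1 (by positivity)).trans ?_
    rw [div_mul_eq_mul_div, div_le_iff₀ hMpos]
    linarith

/-- Takes `M = ⌊n * m / (100 * l)⌋`, which requires `l > 0`. The bound `l ≤ m * n / 40000` makes `M`
positive, so rounding down costs at most a factor `2`. Then `M * √R ≥ n * m * √R / (200 * l) ≥ 200 *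
τ`, whence the constant `40000 = 200 * 200`. -/
lemma exists_not_solves (μ : Measure Ω) [IsProbabilityMeasure μ]
    (P : RoundProtocol Ω R n m d) (hP : P.CostAtMost l) {τ : ℝ} (hτ : 0 < τ)
    (hτN : 2 * τ < (m * n * R : ℕ)) (hd : m * n * R ≤ d)
    (hl : (l : ℝ) ≤ 1 / 40000 * min ((m : ℝ) * n * Real.sqrt R / τ) ((m : ℝ) * n)) :
    ∃ D : Dataset R n m d, ¬ P.SolvesApproxHist μ τ (1 / 5) D := by
  rcases Nat.eq_zero_or_pos l with rfl | hl0
  · exact P.exists_not_solves_of_cost_zero μ hP hτ hτN hd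
  have hR : 0 < R := by
    rcases Nat.eq_zero_or_pos R with rfl | hR
    · simp at hτN; linarith
    · exact hR
  have hl1 : (l : ℝ) ≤ 1 / 40000 * ((m : ℝ) * n) := hl.trans (by gcongr; exact min_le_right _ _)
  have hl2 : (l : ℝ) ≤ 1 / 40000 * ((m : ℝ) * n * Real.sqrt R / τ) :=
    hl.trans (by gcongr; exact min_le_left _ _)
  have hkN : 100 * l ≤ n * m := by
    have : ((100 * l : ℕ) : ℝ) ≤ (n * m : ℕ) := by push_cast; linarith
    exact_mod_cast this
  have hM0 : 0 < n * m / (100 * l) := Nat.div_pos hkN (by omega)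
  have hN : n * m ≤ 200 * l * (n * m / (100 * l)) := by
    have h1 := Nat.lt_mul_div_succ (n * m) (show 0 < 100 * l by omega)
    have h2 : 100 * l * 1 ≤ 100 * l * (n * m / (100 * l)) := Nat.mul_le_mul_left _ hM0
    linarith
  refine P.exists_not_solves_of_weight μ hP hR hl0 hM0 ?_ (Nat.mul_div_le _ _) ?_
  · calc 100 * l ≤ n * m := hkN
      _ = m * n * 1 := by ring
      _ ≤ m * n * R := Nat.mul_le_mul_left _ hR
      _ ≤ d := hd
  · have hlpos : (0 : ℝ) < l := by exact_mod_cast hl0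
    have hN' : (n * m : ℝ) ≤ 200 * l * (n * m / (100 * l) : ℕ) := by exact_mod_cast hN
    have h3 := mul_le_mul_of_nonneg_right hN' (Real.sqrt_nonneg R)
    rw [← mul_div_assoc, le_div_iff₀ hτ] at hl2
    refine le_of_mul_le_mul_left ?_ hlpos
    linarith

end RoundProtocol

theorem theorem4 :
    ∃ c : ℝ, 0 < c ∧
      ∀ (m n R d l : ℕ) (τ : ℝ), 0 < τ → 2 * τ < (m * n * R : ℕ) → m * n * R ≤ d →
        (l : ℝ) ≤ c * min ((m : ℝ) * n * Real.sqrt R / τ) ((m : ℝ) * n) →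
        ∀ (Ω : Type*) [MeasurableSpace Ω] (μ : Measure Ω) [IsProbabilityMeasure μ],
          (∀ P : LinSketchProtocol Ω R n m d, P.CostAtMost l →
            ∃ D : Dataset R n m d, ¬ P.SolvesApproxHist μ τ (1 / 5) D) ∧
          (∀ P : RoundProtocol Ω R n m d, P.CostAtMost l →
            ∃ D : Dataset R n m d, ¬ P.SolvesApproxHist μ τ (1 / 5) D) := by
  refine ⟨1 / 40000, by norm_num, fun m n R d l τ hτ hτN hd hl Ω _ μ _ => ⟨fun P hP => ?_,
    fun P hP => P.exists_not_solves μ hP hτ hτN hd hl⟩⟩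
  exact P.toRoundProtocol.exists_not_solves μ hP hτ hτN hd hl
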